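/- For elements $g,h$ of a finite group $G$ put $\Sigma(g,h)=\bigcup_{i=1}^{|G|}\bigcup_{k\in G}\{k^{-1}g^ik,\;k^{-1}h^ik,\;k^{-1}(gh)^ik\}$. A Beauville structure of $G$ is $\{\{x_1,y_1\},\{x_2,y_2\}\}$ with $\langle x_1,y_1\rangle=\langle x_2,y_2\rangle=G$ and $\Sigma(x_1,y_1)\cap\Sigma(x_2,y_2)=\{e\}$. It is strongly real if there are $\phi\in\mathrm{Aut}(G)$ and $g_1,g_2\in G$ with $g_i\phi(x_i)g_i^{-1}=x_i^{-1}$ and $g_i\phi(y_i)g_i^{-1}=y_i^{-1}$ for $i=1,2$; a group with a strongly real Beauville structure is a strongly real Beauville group. For $n=6,7,8$ let $W(E_n)$ be the Coxeter group of type $E_n$ with simple reflections $s_1,\dots,s_n$ numbered so that the diagram is the chain $s_1 - s_3 - s_4 - \cdots - s_n$ with $s_2$ joined to $s_4$. Lemma. The groups $W(E_6)$, $W(E_7)$ and $W(E_8)$ are strongly real Beauville groups. More explicitly, for each $n\in\{6,7,8\}$ there is an injective homomorphism $\rho_n:W(E_n)\to GL_n(\mathbb{Q})$ that sends $s_1,s_3,s_4,\dots,s_n$,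 in this order, to the permutation matrices of the transpositions $(1,2),(2,3),\dots,(n-1,n)$, and $s_2$ to the matrix of the reflection $v\mapsto v-\bigl(v_1+v_2+v_3-\tfrac13\sum_{j=1}^nv_j\bigr)(e_1+e_2+e_3)$ (matrices act on column vectors). The matrices $x_1,y_1,x_2,y_2,t$ below lie in $\rho_n(W(E_n))$; under the identification by $\rho_n$, $\{\{x_1,y_1\},\{x_2,y_2\}\}$ is a strongly real Beauville structure of $W(E_n)$; and $t$, a permutation matrix, is an involution with $t^{-1}x_it=x_i^{-1}$ and $t^{-1}y_it=y_i^{-1}$ for $i=1,2$. For $n=6$: $$x_1=\begin{pmatrix}0&0&0&0&0&1\\1&0&0&0&0&0\\0&0&0&0&1&0\\0&0&1&0&0&0\\0&1&0&0&0&0\\0&0&0&1&0&0\end{pmatrix},$$ $$y_1=\tfrac13\begin{pmatrix}1&-2&1&-2&1&1\\1&1&1&-2&1&-2\\-1&-1&2&-1&-1&-1\\0&0&3&0&0&0\\-2&1&1&-2&1&1\\1&1&1&-2&-2&1\end{pmatrix},$$ $$x_2=\tfrac13\begin{pmatrix}-2&-2&1&1&1&1\\1&-2&-2&1&1&1\\0&0&0&3&0&0\\-2&1&-2&1&1&1\\0&0&0&0&0&3\\0&0&0&0&3&0\end{pmatrix},$$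 $$y_2=\tfrac13\begin{pmatrix}0&3&0&0&0&0\\-2&1&1&1&1&-2\\0&0&3&0&0&0\\0&0&0&3&0&0\\-2&1&1&1&-2&1\\1&1&1&1&-2&-2\end{pmatrix},$$ $$t=\begin{pmatrix}0&1&0&0&0&0\\1&0&0&0&0&0\\0&0&0&1&0&0\\0&0&1&0&0&0\\0&0&0&0&0&1\\0&0&0&0&1&0\end{pmatrix}.$$ For $n=7$: $$x_1=\tfrac13\begin{pmatrix}1&-2&1&1&-2&1&1\\0&0&3&0&0&0&0\\1&1&1&1&-2&1&-2\\3&0&0&0&0&0&0\\0&0&0&0&0&3&0\\1&-2&1&1&1&1&-2\\0&0&0&3&0&0&0\end{pmatrix},$$ $$y_1=\tfrac13\begin{pmatrix}-1&-1&2&-1&-1&-1&2\\-1&-1&2&-1&-1&2&-1\\0&0&0&0&-3&0&0\\0&0&0&-3&0&0&0\\1&1&1&-2&-2&1&1\\2&-1&2&-1&-1&-1&-1\\-1&2&2&-1&-1&-1&-1\end{pmatrix},$$ $$x_2=\begin{pmatrix}0&0&0&0&0&0&-1\\-1&0&0&0&0&0&0\\0&-1&0&0&0&0&0\\0&0&-1&0&0&0&0\\0&0&0&-1&0&0&0\\0&0&0&0&-1&0&0\\0&0&0&0&0&-1&0\end{pmatrix},$$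 $$y_2=\tfrac13\begin{pmatrix}0&0&0&0&0&3&0\\0&0&0&0&0&0&3\\1&-2&-2&1&1&1&1\\-2&1&-2&1&1&1&1\\-1&-1&-1&-1&-1&2&2\\1&1&-2&1&-2&1&1\\1&1&-2&-2&1&1&1\end{pmatrix},$$ $$t=\begin{pmatrix}0&0&0&0&0&0&1\\0&0&0&0&0&1&0\\0&0&0&0&1&0&0\\0&0&0&1&0&0&0\\0&0&1&0&0&0&0\\0&1&0&0&0&0&0\\1&0&0&0&0&0&0\end{pmatrix}.$$ For $n=8$: $$x_1=\begin{pmatrix}0&0&0&0&1&0&0&0\\1&0&0&0&0&0&0&0\\0&0&0&0&0&0&1&0\\0&0&0&0&0&0&0&1\\0&0&0&0&0&1&0&0\\0&1&0&0&0&0&0&0\\0&0&0&1&0&0&0&0\\0&0&1&0&0&0&0&0\end{pmatrix},$$ $$y_1=\tfrac13\begin{pmatrix}1&1&1&-2&1&1&-2&-2\\1&1&1&-2&-2&1&-2&1\\0&0&0&-3&0&0&0&0\\1&1&1&-2&-2&1&1&-2\\0&0&0&-3&0&3&0&0\\-1&2&-1&-1&-1&2&-1&-1\\-1&-1&2&-1&-1&2&-1&-1\\2&-1&-1&-1&-1&2&-1&-1\end{pmatrix},$$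 $$x_2=\begin{pmatrix}1&0&0&0&0&0&0&0\\0&1&0&0&0&0&0&0\\0&0&0&0&0&1&0&0\\0&0&1&0&0&0&0&0\\0&0&0&1&0&0&0&0\\0&0&0&0&0&0&1&0\\0&0&0&0&1&0&0&0\\0&0&0&0&0&0&0&1\end{pmatrix},$$ $$y_2=\tfrac13\begin{pmatrix}2&2&-1&-1&2&-1&-1&-1\\2&2&-1&-1&-1&-1&-1&2\\1&1&1&-2&1&-2&-2&1\\1&1&-2&1&1&-2&-2&1\\2&2&-1&-1&-1&-1&-1&-1\\0&3&0&0&0&-3&0&0\\1&1&-2&-2&1&-2&1&1\\3&0&0&0&0&-3&0&0\end{pmatrix},$$ $$t=\begin{pmatrix}0&1&0&0&0&0&0&0\\1&0&0&0&0&0&0&0\\0&0&0&1&0&0&0&0\\0&0&1&0&0&0&0&0\\0&0&0&0&0&1&0&0\\0&0&0&0&1&0&0&0\\0&0&0&0&0&0&1&0\\0&0&0&0&0&0&0&1\end{pmatrix}.$$ -/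

import Mathlib

namespace BeauvilleCoxeter

section General

variable {G : Type*} [Group G]

/-- `Σ(g, h)`: the conjugates `u ^ k = k⁻¹ u k` of the powers of `g`, `h` and `g h`,
with exponents running from `1` to `|G|`. -/
def sigmaSet (g h : G) : Set G :=
  ⋃ i ∈ Set.Icc 1 (Nat.card G), ⋃ k : G,
    {k⁻¹ * g ^ i * k, k⁻¹ * h ^ i * k, k⁻¹ * (g * h) ^ i * k}

/-- `{{x₁, y₁}, {x₂, y₂}}` is an (unmixed) Beauville structure of the finite group `G`. -/
structure IsBeauvilleStructure (x₁ y₁ x₂ y₂ : G) : Prop where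
  finite : Finite G
  generates_left : Subgroup.closure {x₁, y₁} = ⊤
  generates_right : Subgroup.closure {x₂, y₂} = ⊤
  sigma_inter : sigmaSet x₁ y₁ ∩ sigmaSet x₂ y₂ = {1}

/-- `{{x₁, y₁}, {x₂, y₂}}` is a strongly real Beauville structure of `G`. -/
def IsStronglyRealBeauvilleStructure (x₁ y₁ x₂ y₂ : G) : Prop :=
  IsBeauvilleStructure x₁ y₁ x₂ y₂ ∧
    ∃ (φ : G ≃* G) (g₁ g₂ : G),
      (g₁ * φ x₁ * g₁⁻¹ = x₁⁻¹ ∧ g₁ * φ y₁ * g₁⁻¹ = y₁⁻¹) ∧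
      (g₂ * φ x₂ * g₂⁻¹ = x₂⁻¹ ∧ g₂ * φ y₂ * g₂⁻¹ = y₂⁻¹)

variable (G) in
/-- `G` is a strongly real Beauville group. -/
def IsStronglyRealBeauvilleGroup : Prop :=
  ∃ x₁ y₁ x₂ y₂ : G, IsStronglyRealBeauvilleStructure x₁ y₁ x₂ y₂

end General

/-- The matrix of the reflection `v ↦ v - c(v) α` of `ℚⁿ`, where `α = e₁ + e₂ + e₃` and
`c(v) = v₁ + v₂ + v₃ - (v₁ + ⋯ + vₙ) / 3`. -/
def tripleReflection (n : ℕ) : Matrix (Fin n) (Fin n) ℚ :=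
  Matrix.of fun i j =>
    (if i = j then 1 else 0) -
      (if (i : ℕ) < 3 then 1 else 0) * (if (j : ℕ) < 3 then 2 / 3 else -1 / 3)

/-- The matrices of the simple reflections of `W(E₆)`, nodes numbered as in `CoxeterMatrix.E₆`:
the node off the long chain goes to `tripleReflection`, the chain goes to the permutation
matrices of adjacent transpositions. -/
def e6Simple : Fin 6 → Matrix (Fin 6) (Fin 6) ℚ :=
  ![Matrix.swap ℚ 0 1, tripleReflection 6, Matrix.swap ℚ 1 2, Matrix.swap ℚ 2 3,
    Matrix.swap ℚ 3 4, Matrix.swap ℚ 4 5]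

/-- As `e6Simple`, for `W(E₇)`. -/
def e7Simple : Fin 7 → Matrix (Fin 7) (Fin 7) ℚ :=
  ![Matrix.swap ℚ 0 1, tripleReflection 7, Matrix.swap ℚ 1 2, Matrix.swap ℚ 2 3,
    Matrix.swap ℚ 3 4, Matrix.swap ℚ 4 5, Matrix.swap ℚ 5 6]

/-- As `e6Simple`, for `W(E₈)`. -/
def e8Simple : Fin 8 → Matrix (Fin 8) (Fin 8) ℚ :=
  ![Matrix.swap ℚ 0 1, tripleReflection 8, Matrix.swap ℚ 1 2, Matrix.swap ℚ 2 3,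
    Matrix.swap ℚ 3 4, Matrix.swap ℚ 4 5, Matrix.swap ℚ 5 6, Matrix.swap ℚ 6 7]

def e6X1 : Matrix (Fin 6) (Fin 6) ℚ :=
  !![0, 0, 0, 0, 0, 1;
    1, 0, 0, 0, 0, 0;
    0, 0, 0, 0, 1, 0;
    0, 0, 1, 0, 0, 0;
    0, 1, 0, 0, 0, 0;
    0, 0, 0, 1, 0, 0]

def e6Y1 : Matrix (Fin 6) (Fin 6) ℚ :=
  (1 / 3 : ℚ) • !![1, -2, 1, -2, 1, 1;
    1, 1, 1, -2, 1, -2;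
    -1, -1, 2, -1, -1, -1;
    0, 0, 3, 0, 0, 0;
    -2, 1, 1, -2, 1, 1;
    1, 1, 1, -2, -2, 1]

def e6X2 : Matrix (Fin 6) (Fin 6) ℚ :=
  (1 / 3 : ℚ) • !![-2, -2, 1, 1, 1, 1;
    1, -2, -2, 1, 1, 1;
    0, 0, 0, 3, 0, 0;
    -2, 1, -2, 1, 1, 1;
    0, 0, 0, 0, 0, 3;
    0, 0, 0, 0, 3, 0]

def e6Y2 : Matrix (Fin 6) (Fin 6) ℚ :=
  (1 / 3 : ℚ) • !![0, 3, 0, 0, 0, 0;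
    -2, 1, 1, 1, 1, -2;
    0, 0, 3, 0, 0, 0;
    0, 0, 0, 3, 0, 0;
    -2, 1, 1, 1, -2, 1;
    1, 1, 1, 1, -2, -2]

def e6T : Matrix (Fin 6) (Fin 6) ℚ :=
  !![0, 1, 0, 0, 0, 0;
    1, 0, 0, 0, 0, 0;
    0, 0, 0, 1, 0, 0;
    0, 0, 1, 0, 0, 0;
    0, 0, 0, 0, 0, 1;
    0, 0, 0, 0, 1, 0]

def e7X1 : Matrix (Fin 7) (Fin 7) ℚ :=
  (1 / 3 : ℚ) • !![1, -2, 1, 1, -2, 1, 1;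
    0, 0, 3, 0, 0, 0, 0;
    1, 1, 1, 1, -2, 1, -2;
    3, 0, 0, 0, 0, 0, 0;
    0, 0, 0, 0, 0, 3, 0;
    1, -2, 1, 1, 1, 1, -2;
    0, 0, 0, 3, 0, 0, 0]

def e7Y1 : Matrix (Fin 7) (Fin 7) ℚ :=
  (1 / 3 : ℚ) • !![-1, -1, 2, -1, -1, -1, 2;
    -1, -1, 2, -1, -1, 2, -1;
    0, 0, 0, 0, -3, 0, 0;
    0, 0, 0, -3, 0, 0, 0;
    1, 1, 1, -2, -2, 1, 1;
    2, -1, 2, -1, -1, -1, -1;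
    -1, 2, 2, -1, -1, -1, -1]

def e7X2 : Matrix (Fin 7) (Fin 7) ℚ :=
  !![0, 0, 0, 0, 0, 0, -1;
    -1, 0, 0, 0, 0, 0, 0;
    0, -1, 0, 0, 0, 0, 0;
    0, 0, -1, 0, 0, 0, 0;
    0, 0, 0, -1, 0, 0, 0;
    0, 0, 0, 0, -1, 0, 0;
    0, 0, 0, 0, 0, -1, 0]

def e7Y2 : Matrix (Fin 7) (Fin 7) ℚ :=
  (1 / 3 : ℚ) • !![0, 0, 0, 0, 0, 3, 0;
    0, 0, 0, 0, 0, 0, 3;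
    1, -2, -2, 1, 1, 1, 1;
    -2, 1, -2, 1, 1, 1, 1;
    -1, -1, -1, -1, -1, 2, 2;
    1, 1, -2, 1, -2, 1, 1;
    1, 1, -2, -2, 1, 1, 1]

def e7T : Matrix (Fin 7) (Fin 7) ℚ :=
  !![0, 0, 0, 0, 0, 0, 1;
    0, 0, 0, 0, 0, 1, 0;
    0, 0, 0, 0, 1, 0, 0;
    0, 0, 0, 1, 0, 0, 0;
    0, 0, 1, 0, 0, 0, 0;
    0, 1, 0, 0, 0, 0, 0;
    1, 0, 0, 0, 0, 0, 0]

def e8X1 : Matrix (Fin 8) (Fin 8) ℚ :=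
  !![0, 0, 0, 0, 1, 0, 0, 0;
    1, 0, 0, 0, 0, 0, 0, 0;
    0, 0, 0, 0, 0, 0, 1, 0;
    0, 0, 0, 0, 0, 0, 0, 1;
    0, 0, 0, 0, 0, 1, 0, 0;
    0, 1, 0, 0, 0, 0, 0, 0;
    0, 0, 0, 1, 0, 0, 0, 0;
    0, 0, 1, 0, 0, 0, 0, 0]

def e8Y1 : Matrix (Fin 8) (Fin 8) ℚ :=
  (1 / 3 : ℚ) • !![1, 1, 1, -2, 1, 1, -2, -2;
    1, 1, 1, -2, -2, 1, -2, 1;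
    0, 0, 0, -3, 0, 0, 0, 0;
    1, 1, 1, -2, -2, 1, 1, -2;
    0, 0, 0, -3, 0, 3, 0, 0;
    -1, 2, -1, -1, -1, 2, -1, -1;
    -1, -1, 2, -1, -1, 2, -1, -1;
    2, -1, -1, -1, -1, 2, -1, -1]

def e8X2 : Matrix (Fin 8) (Fin 8) ℚ :=
  !![1, 0, 0, 0, 0, 0, 0, 0;
    0, 1, 0, 0, 0, 0, 0, 0;
    0, 0, 0, 0, 0, 1, 0, 0;
    0, 0, 1, 0, 0, 0, 0, 0;
    0, 0, 0, 1, 0, 0, 0, 0;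
    0, 0, 0, 0, 0, 0, 1, 0;
    0, 0, 0, 0, 1, 0, 0, 0;
    0, 0, 0, 0, 0, 0, 0, 1]

def e8Y2 : Matrix (Fin 8) (Fin 8) ℚ :=
  (1 / 3 : ℚ) • !![2, 2, -1, -1, 2, -1, -1, -1;
    2, 2, -1, -1, -1, -1, -1, 2;
    1, 1, 1, -2, 1, -2, -2, 1;
    1, 1, -2, 1, 1, -2, -2, 1;
    2, 2, -1, -1, -1, -1, -1, -1;
    0, 3, 0, 0, 0, -3, 0, 0;
    1, 1, -2, -2, 1, -2, 1, 1;
    3, 0, 0, 0, 0, -3, 0, 0]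

def e8T : Matrix (Fin 8) (Fin 8) ℚ :=
  !![0, 1, 0, 0, 0, 0, 0, 0;
    1, 0, 0, 0, 0, 0, 0, 0;
    0, 0, 0, 1, 0, 0, 0, 0;
    0, 0, 1, 0, 0, 0, 0, 0;
    0, 0, 0, 0, 0, 1, 0, 0;
    0, 0, 0, 0, 1, 0, 0, 0;
    0, 0, 0, 0, 0, 0, 1, 0;
    0, 0, 0, 0, 0, 0, 0, 1]

end BeauvilleCoxeter

/-!
The matrices `e6Simple`, `e7Simple`, `e8Simple` are the reflections in a system of simple roots of
type `Eₙ` for the form `u · v - (∑ u) (∑ v) / 9` on `ℚⁿ`; the roots are the vectors of norm `2` in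
the lattice of all `v ∈ ℤⁿ` with `3 ∣ ∑ v`. The form is positive definite for `n < 9`, so there are
finitely many roots (`finite_setOf_isRoot`).

The products of these reflections satisfy the Coxeter relations, which gives `ρ`. It is faithful by
Tits' argument: if `w s` is longer than `w`, then `w` sends the simple root of `s` to a sum of
simple roots (`mulVec_root_mem_closure`). In the simply laced case this is an induction on the
length of `w` that uses only the commutation and braid relations. Hence an element fixing the
simple roots is trivial (`eq_one_of_forall_mulVec_root`), and the group embeds into the functions
from simple roots to roots, so it is finite (`exists_faithful_representation`).

As `ρ` is injective, every other claim becomes a finite set of identities between rational matrices,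
collected in `Certificate`.

* Membership: each of the given matrices is a product of simple reflections.
* Generation: some word in `x, y` is a reflection, conjugate by a further word to a simple
  reflection, and that one is conjugate by words in `x, y` to all the others.
* `Σ(x₁, y₁) ∩ Σ(x₂, y₂) = {1}`: the pair formed by the trace of an element and the trace of its
  square is a conjugation invariant, and it takes different values on the nontrivial powers of
  `x₁, y₁, x₁ y₁` and on the powers of `x₂, y₂, x₂ y₂`.
* Strong reality: `x t x = t` says that `t` inverts `x` by conjugation, so the identity
  automorphism and `g₁ = g₂ = t⁻¹` serve.

All these matrices have entries in `(1/3) ℤ`, and the long products are evaluated on lists of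
integers, where a product of `k` matrices is carried with the factor `3 ^ k`
(`prod_eq_prod`, `hasTraces_of_traceCheck`).
-/

namespace BeauvilleCoxeter

open Matrix CoxeterSystem

/-! ### The reflections of the del Pezzo form -/

section Reflections

variable {n : ℕ}

/-- The symmetric bilinear form `u · v - (∑ u) (∑ v) / 9` on `ℚⁿ`; it is positive definite for
`n < 9`. -/
def form (u v : Fin n → ℚ) : ℚ := u ⬝ᵥ v - (∑ i, u i) * (∑ i, v i) / 9

/-- The linear functional `form a`, as a vector. -/
def coroot (a : Fin n → ℚ) : Fin n → ℚ := fun j => a j - (∑ i, a i) / 9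

/-- The matrix of `v ↦ v - form a v • a`, the reflection in `a` when `form a a = 2`. -/
def refl (a : Fin n → ℚ) : Matrix (Fin n) (Fin n) ℚ := 1 - vecMulVec a (coroot a)

lemma form_comm (u v : Fin n → ℚ) : form u v = form v u := by
  simp only [form, dotProduct_comm u v, mul_comm]

lemma form_sub_smul (u v w : Fin n → ℚ) (c : ℚ) :
    form u (v - c • w) = form u v - c * form u w := by
  simp only [form, dotProduct_sub, dotProduct_smul, Pi.sub_apply, Pi.smul_apply, smul_eq_mul,
    Finset.sum_sub_distrib, ← Finset.mul_sum]
  ring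

lemma form_add (u v w : Fin n → ℚ) : form u (v + w) = form u v + form u w := by
  simpa [sub_eq_add_neg] using form_sub_smul u v w (-1)

lemma coroot_dotProduct (a v : Fin n → ℚ) : coroot a ⬝ᵥ v = form a v := by
  simp only [coroot, form, dotProduct, sub_mul, Finset.sum_sub_distrib, ← Finset.mul_sum]
  ring

lemma refl_mulVec (a v : Fin n → ℚ) : refl a *ᵥ v = v - form a v • a := by
  rw [refl, sub_mulVec, one_mulVec, vecMulVec_mulVec, coroot_dotProduct, op_smul_eq_smul]

lemma refl_mul_refl_self {a : Fin n → ℚ} (ha : form a a = 2) : refl a * refl a = 1 := by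
  refine ext_of_mulVec_single fun i => ?_
  simp only [← mulVec_mulVec, refl_mulVec, form_sub_smul, ha, one_mulVec]
  module

lemma refl_mul_refl_comm {a b : Fin n → ℚ} (hab : form a b = 0) :
    refl a * refl b = refl b * refl a := by
  refine ext_of_mulVec_single fun i => ?_
  simp only [← mulVec_mulVec, refl_mulVec, form_sub_smul, hab, form_comm b a]
  module

lemma refl_braid {a b : Fin n → ℚ} (ha : form a a = 2) (hb : form b b = 2)
    (hab : form a b = -1) : refl a * refl b * refl a = refl b * refl a * refl b := by
  refine ext_of_mulVec_single fun i => ?_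
  simp only [← mulVec_mulVec, refl_mulVec, form_sub_smul, ha, hb, hab, form_comm b a]
  module

/-- The roots: the vectors `v` of the lattice `{v ∈ ℤⁿ : 3 ∣ ∑ v}` with `form v v = 2`. -/
def IsRoot (v : Fin n → ℚ) : Prop :=
  form v v = 2 ∧ ∃ (z : Fin n → ℤ) (d : ℤ), (∀ i, v i = z i) ∧ ∑ i, z i = 3 * d

lemma IsRoot.refl_mulVec {a v : Fin n → ℚ} (ha : IsRoot a) (hv : IsRoot v) :
    IsRoot (refl a *ᵥ v) := by
  obtain ⟨ha2, y, c, hy, hc⟩ := ha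
  obtain ⟨hv2, z, d, hz, hd⟩ := hv
  have sum_a : ∑ i, a i = 3 * c := by simp only [hy]; exact_mod_cast hc
  have sum_v : ∑ i, v i = 3 * d := by simp only [hz]; exact_mod_cast hd
  have hform : form a v = ((∑ i, y i * z i - c * d : ℤ) : ℚ) := by
    rw [form, sum_a, sum_v]
    push_cast
    simp only [dotProduct, hy, hz]
    ring
  rw [BeauvilleCoxeter.refl_mulVec]
  refine ⟨?_, fun i => z i - (∑ i, y i * z i - c * d) * y i,
    d - (∑ i, y i * z i - c * d) * c, fun i => ?_, ?_⟩
  · rw [form_sub_smul, form_comm _ v, form_comm _ a, form_sub_smul, form_sub_smul, ha2, hv2,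
      form_comm v a]
    ring
  · simp only [Pi.sub_apply, Pi.smul_apply, smul_eq_mul, hform, hy, hz]
    push_cast
    ring
  · rw [Finset.sum_sub_distrib, ← Finset.mul_sum, hc, hd]
    ring

/-- For `n < 9` there are finitely many roots: by Cauchy-Schwarz `(9 - n) ∑ vᵢ² ≤ 18`. -/
lemma finite_setOf_isRoot (hn : n < 9) : {v : Fin n → ℚ | IsRoot v}.Finite := by
  refine ((Set.finite_Icc (fun _ => -18 : Fin n → ℤ) fun _ => 18).image
    fun z i => (z i : ℚ)).subset ?_
  rintro v ⟨hv, z, d, hz, hd⟩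
  have key : ∑ i, z i ^ 2 ≤ 18 := by
    have hcs : (∑ i, z i) ^ 2 ≤ n * ∑ i, z i ^ 2 := by
      simpa using sq_sum_le_card_mul_sum_sq (s := Finset.univ) (f := z)
    have hsq : ∑ i, z i ^ 2 - d ^ 2 = 2 := by
      have hs : ∑ i, v i = 3 * d := by simp only [hz]; exact_mod_cast hd
      rw [form, hs] at hv
      simp only [dotProduct, hz, ← pow_two] at hv
      have : ∑ i, (z i : ℚ) ^ 2 - (d : ℚ) ^ 2 = 2 := by linarith
      exact_mod_cast this
    have hn' : (n : ℤ) ≤ 8 := by omega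
    have hnonneg : 0 ≤ ∑ i, z i ^ 2 := Finset.sum_nonneg fun i _ => sq_nonneg _
    rw [hd] at hcs
    nlinarith [mul_le_mul_of_nonneg_right hn' hnonneg]
  have hle : ∀ i, z i ^ 2 ≤ 18 := fun i =>
    (Finset.single_le_sum (fun j _ => sq_nonneg (z j)) (Finset.mem_univ i)).trans key
  exact ⟨z, ⟨fun i => by nlinarith [hle i], fun i => by nlinarith [hle i]⟩,
    funext fun i => (hz i).symm⟩

end Reflections

/-! ### Faithfulness of a reflection representation -/

section Faithful

variable {n : ℕ} {B W : Type*} [Group W] {M : CoxeterMatrix B} (cs : CoxeterSystem M W)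
  {ρ : W →* Matrix (Fin n) (Fin n) ℚ} {α : B → Fin n → ℚ}

/-- Tits' lemma for a simply laced system: if right multiplication by `s` lengthens `w`, then `w`
sends the simple root of `s` to a sum of simple roots. -/
theorem mulVec_root_mem_closure (hM : ∀ i j, i ≠ j → M i j = 2 ∨ M i j = 3)
    (hρ : ∀ i, ρ (cs.simple i) = refl (α i)) (hself : ∀ i, form (α i) (α i) = 2)
    (hcomm : ∀ i j, M i j = 2 → form (α i) (α j) = 0)
    (hbraid : ∀ i j, M i j = 3 → form (α i) (α j) = -1) (w : W) (i : B)
    (hi : cs.length w < cs.length (w * cs.simple i)) :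
    ρ w *ᵥ α i ∈ AddSubmonoid.closure (Set.range α) := by
  induction hk : cs.length w using Nat.strong_induction_on generalizing w i with
  | _ k ih =>
  subst hk
  by_cases hw : w = 1
  · subst hw
    simpa using AddSubmonoid.subset_closure (Set.mem_range_self i)
  obtain ⟨j, hj⟩ := cs.exists_rightDescent_of_ne_one hw
  rw [IsRightDescent] at hj
  have hij : i ≠ j := by rintro rfl; omega
  -- Peel off a right descent: `w = v sⱼ` with `v` shorter than `w`.
  obtain ⟨v, rfl⟩ : ∃ v, w = v * cs.simple j := ⟨w * cs.simple j, by simp⟩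
  simp only [simple_mul_simple_cancel_right] at hj
  have hvj := cs.length_mul_simple v j
  rw [map_mul, hρ, ← mulVec_mulVec, refl_mulVec]
  rcases hM j i hij.symm with h2 | h3
  · have hst : cs.simple j * cs.simple i = cs.simple i * cs.simple j := by
      have h := cs.simple_mul_simple_pow j i
      rw [h2, pow_two, mul_eq_one_iff_eq_inv] at h
      simpa using h
    -- `w αᵢ = v αᵢ`, and `v sᵢ` is longer than `v` since `w sᵢ = v sᵢ sⱼ` is longer than `w`.
    rw [hcomm j i h2, zero_smul, sub_zero]
    refine ih _ hj v i ?_ rfl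
    rw [mul_assoc, hst, ← mul_assoc] at hi
    have h1 := cs.length_mul_simple (v * cs.simple i) j
    omega
  · have hst : cs.simple j * cs.simple i * cs.simple j =
        cs.simple i * cs.simple j * cs.simple i := by
      have h := cs.simple_mul_simple_pow j i
      have h' : cs.simple j * cs.simple i * cs.simple j *
          (cs.simple i * cs.simple j * cs.simple i) = 1 := by
        simpa [h3, pow_three, mul_assoc] using h
      simpa [mul_assoc] using eq_inv_of_mul_eq_one_left h'
    -- `w αᵢ = v (αᵢ + αⱼ)`.
    rw [hbraid j i h3, neg_one_smul, sub_neg_eq_add]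
    by_cases hvi : cs.length v < cs.length (v * cs.simple i)
    · rw [mulVec_add]
      exact add_mem (ih _ hj v i hvi rfl) (ih _ hj v j (by omega) rfl)
    · -- Now `w = u sᵢ sⱼ` with the lengths adding up, and `w αᵢ = u αⱼ`. If `u sⱼ` were shorter
      -- than `u`, then `w sᵢ = u sⱼ sᵢ sⱼ` would be shorter than `w`.
      obtain ⟨u, rfl⟩ : ∃ u, v = u * cs.simple i := ⟨v * cs.simple i, by simp⟩
      simp only [simple_mul_simple_cancel_right] at hvi
      have hne := cs.length_mul_simple u i
      rw [map_mul, hρ, ← mulVec_mulVec, refl_mulVec, form_add, hself,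
        hbraid i j (M.symmetric i j ▸ h3), show (2 + -1 : ℚ) = 1 by norm_num, one_smul,
        add_sub_cancel_left]
      refine ih _ (by omega) u j ?_ rfl
      have h1 := cs.length_mul_simple u j
      have h2 := cs.length_mul_simple (u * cs.simple j) i
      have h3 := cs.length_mul_simple (u * cs.simple j * cs.simple i) j
      have h4 : u * cs.simple i * cs.simple j * cs.simple i =
          u * cs.simple j * cs.simple i * cs.simple j := by
        simp only [mul_assoc] at hst ⊢
        rw [hst]
      rw [h4] at hi
      omega

/-- A functional that is positive on the simple roots detects that no `w ≠ 1` fixes them all: a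
right descent `s` of `w` makes the image of the root of `s` negative. -/
theorem eq_one_of_forall_mulVec_root (hM : ∀ i j, i ≠ j → M i j = 2 ∨ M i j = 3)
    (hρ : ∀ i, ρ (cs.simple i) = refl (α i)) (hself : ∀ i, form (α i) (α i) = 2)
    (hcomm : ∀ i j, M i j = 2 → form (α i) (α j) = 0)
    (hbraid : ∀ i j, M i j = 3 → form (α i) (α j) = -1)
    (height : Fin n → ℚ) (hheight : ∀ i, 0 < height ⬝ᵥ α i) {w : W}
    (hw : ∀ i, ρ w *ᵥ α i = α i) : w = 1 := by
  by_contra hne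
  obtain ⟨i, hi⟩ := cs.exists_rightDescent_of_ne_one hne
  rw [IsRightDescent] at hi
  have hmem := mulVec_root_mem_closure cs hM hρ hself hcomm hbraid (w * cs.simple i) i
    (by simpa using hi)
  have hnonneg : ∀ v ∈ AddSubmonoid.closure (Set.range α), 0 ≤ height ⬝ᵥ v := by
    intro v hv
    induction hv using AddSubmonoid.closure_induction with
    | mem v hv => obtain ⟨j, rfl⟩ := hv; exact (hheight j).le
    | zero => simp
    | add u v _ _ hu hv => rw [dotProduct_add]; exact add_nonneg hu hv
  have hneg : ρ (w * cs.simple i) *ᵥ α i = -α i := by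
    rw [map_mul, hρ, ← mulVec_mulVec, refl_mulVec, hself, mulVec_sub, mulVec_smul, hw]
    module
  have := hnonneg _ hmem
  rw [hneg, dotProduct_neg] at this
  linarith [hheight i]

end Faithful

section Representation

variable {n : ℕ} {B : Type*} [Finite B] {M : CoxeterMatrix B} {α : B → Fin n → ℚ}

/-- A simply laced Coxeter group whose diagram is realized by roots in `ℚⁿ`, `n < 9`, on the
positive side of a hyperplane is finite and acts faithfully by reflections. -/
theorem exists_faithful_representation (hn : n < 9)
    (hdiag : ∀ i, M i i = 1) (hM : ∀ i j, i ≠ j → M i j = 2 ∨ M i j = 3)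
    (hroot : ∀ i, IsRoot (α i))
    (hcomm : ∀ i j, M i j = 2 → form (α i) (α j) = 0)
    (hbraid : ∀ i j, M i j = 3 → form (α i) (α j) = -1)
    (height : Fin n → ℚ) (hheight : ∀ i, 0 < height ⬝ᵥ α i) :
    ∃ ρ : M.Group →* Matrix (Fin n) (Fin n) ℚ, Function.Injective ρ ∧
      (∀ i, ρ (M.simple i) = refl (α i)) ∧ Finite M.Group := by
  have hself i : form (α i) (α i) = 2 := (hroot i).1
  have hsq i : refl (α i) * refl (α i) = 1 := refl_mul_refl_self (hself i)
  have hlift : M.IsLiftable fun i => refl (α i) := by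
    intro i j
    rcases eq_or_ne i j with rfl | hij
    · rw [hdiag, pow_one, hsq]
    · rcases hM i j hij with h2 | h3
      · rw [h2, pow_two, mul_assoc, ← mul_assoc (refl (α j)), ← refl_mul_refl_comm (hcomm i j h2),
          mul_assoc (refl (α i)), hsq, mul_one, hsq]
      · have hb := refl_braid (hself i) (hself j) (hbraid i j h3)
        calc (refl (α i) * refl (α j)) ^ M i j
            = (refl (α i) * refl (α j) * refl (α i)) *
                (refl (α j) * refl (α i) * refl (α j)) := by
              rw [h3]; noncomm_ring
          _ = refl (α j) * refl (α i) * (refl (α j) * refl (α j)) * (refl (α i) * refl (α j)) := by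
              rw [hb]; noncomm_ring
          _ = refl (α j) * (refl (α i) * refl (α i)) * refl (α j) := by
              rw [hsq]; noncomm_ring
          _ = 1 := by rw [hsq, mul_one, hsq]
  let cs := M.toCoxeterSystem
  let ρ := cs.lift ⟨_, hlift⟩
  have hρ i : ρ (M.simple i) = refl (α i) := cs.lift_apply_simple hlift i
  have hfix {w : M.Group} (hw : ∀ i, ρ w *ᵥ α i = α i) : w = 1 :=
    eq_one_of_forall_mulVec_root cs hM hρ hself hcomm hbraid height hheight hw
  have hcancel {w w' : M.Group} (h : ∀ i, ρ w *ᵥ α i = ρ w' *ᵥ α i) : w = w' := by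
    refine (inv_mul_eq_one.mp (hfix fun i => ?_)).symm
    rw [map_mul, ← mulVec_mulVec, h, mulVec_mulVec, ← map_mul, inv_mul_cancel, map_one,
      one_mulVec]
  have hmem (w : M.Group) : ∀ v, IsRoot v → IsRoot (ρ w *ᵥ v) := by
    induction w using cs.simple_induction_left with
    | one => simp
    | mul_simple_left w i ih =>
      intro v hv
      rw [map_mul, ← mulVec_mulVec]
      exact (hρ i).symm ▸ (hroot i).refl_mulVec (ih v hv)
  refine ⟨ρ, fun w w' h => hcancel fun i => by rw [h], hρ, ?_⟩
  have : Finite {v : Fin n → ℚ | IsRoot v} := (finite_setOf_isRoot hn).to_subtype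
  exact Finite.of_injective
    (fun w (i : B) => (⟨ρ w *ᵥ α i, hmem w _ (hroot i)⟩ : {v : Fin n → ℚ | IsRoot v}))
    fun w w' h => hcancel fun i => congrArg Subtype.val (congrFun h i)

end Representation

/-! ### The Beauville condition -/

section Beauville

variable {G : Type*} [Group G]

/-- The two sets `Σ` meet only in `1` if a conjugation invariant takes different values on the
nontrivial powers of `x₁, y₁, x₁ y₁` and on the powers of `x₂, y₂, x₂ y₂`. -/
lemma sigmaSet_inter_eq_one [Finite G] {β : Type*} (f : G → β)
    (hf : ∀ g k : G, f (k⁻¹ * g * k) = f g) {x₁ y₁ x₂ y₂ : G}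
    (h : ∀ u ∈ ({x₁, y₁, x₁ * y₁} : Set G), ∀ v ∈ ({x₂, y₂, x₂ * y₂} : Set G), ∀ i j : ℕ,
      f (u ^ i) = f (v ^ j) → u ^ i = 1) :
    sigmaSet x₁ y₁ ∩ sigmaSet x₂ y₂ = {1} := by
  have mem_iff (x y g : G) : g ∈ sigmaSet x y ↔ ∃ i ∈ Set.Icc 1 (Nat.card G), ∃ k : G,
      ∃ u ∈ ({x, y, x * y} : Set G), g = k⁻¹ * u ^ i * k := by
    simp [sigmaSet]
  have one_mem (x y : G) : 1 ∈ sigmaSet x y :=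
    (mem_iff _ _ _).2 ⟨Nat.card G, ⟨Nat.card_pos, le_rfl⟩, 1, x, by simp, by simp⟩
  refine Set.Subset.antisymm ?_ (Set.singleton_subset_iff.2 ⟨one_mem _ _, one_mem _ _⟩)
  rintro g ⟨h₁, h₂⟩
  obtain ⟨i, -, k, u, hu, rfl⟩ := (mem_iff _ _ _).1 h₁
  obtain ⟨j, -, l, v, hv, hg⟩ := (mem_iff _ _ _).1 h₂
  have hfe := congrArg f hg
  rw [hf, hf] at hfe
  simp [h u hu v hv i j hfe]

/-- `x t x = t` is the inverse-free form of the statement that `t` inverts `x`. -/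
lemma conj_eq_inv_of_mul_mul_eq {x t : G} (h : x * t * x = t) : t⁻¹ * x * t = x⁻¹ := by
  rw [eq_inv_iff_mul_eq_one, mul_assoc, mul_assoc, ← mul_assoc x, h, inv_mul_cancel]

end Beauville

/-! ### Integer arithmetic for matrices with entries in `(1/3) ℤ` -/

section Lists

/-- A matrix given by the list of its rows; missing entries are `0`. -/
def toMat (n : ℕ) (A : List (List ℤ)) : Matrix (Fin n) (Fin n) ℚ :=
  of fun i j => ((A.getD i []).getD j 0 : ℚ)

/-- `a • l + m` for lists of coordinates, where missing entries are `0`. -/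
def smulAdd (a : ℤ) : List ℤ → List ℤ → List ℤ
  | [], m => m
  | x :: l, [] => a * x :: smulAdd a l []
  | x :: l, y :: m => (a * x + y) :: smulAdd a l m

/-- The combination of the first `n` rows of a matrix with the coefficients in a list. -/
def rowComb : ℕ → List ℤ → List (List ℤ) → List ℤ
  | 0, _, _ => []
  | n + 1, r, A => smulAdd (r.headD 0) (A.headD []) (rowComb n r.tail A.tail)

/-- The product of two `n × n` matrices given by their rows. -/
def listMul (n : ℕ) (A B : List (List ℤ)) : List (List ℤ) :=
  A.map fun r => rowComb n r B

/-- The rows of the scalar matrix `c`. -/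
def listScalar (n : ℕ) (c : ℤ) : List (List ℤ) :=
  List.ofFn fun i : Fin n => List.ofFn fun j : Fin n => if i = j then c else 0

/-- The trace of an `n × n` matrix given by its rows. -/
def listTrace : ℕ → List (List ℤ) → ℤ
  | 0, _ => 0
  | n + 1, A => (A.headD []).headD 0 + listTrace n (A.tail.map List.tail)

/-- The rows of `3 X`, for a matrix `X` with entries in `(1/3) ℤ`. -/
def tripleRows {n : ℕ} (X : Matrix (Fin n) (Fin n) ℚ) : List (List ℤ) :=
  List.ofFn fun i => List.ofFn fun j => (3 * X i j).num

lemma getD_smulAdd (a : ℤ) (l m : List ℤ) (j : ℕ) :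
    (smulAdd a l m).getD j 0 = a * l.getD j 0 + m.getD j 0 := by
  induction l generalizing m j with
  | nil => simp [smulAdd]
  | cons x l ih => cases m <;> cases j <;> simp_all [smulAdd]

lemma getD_rowComb (n : ℕ) (r : List ℤ) (A : List (List ℤ)) (j : ℕ) :
    (rowComb n r A).getD j 0 = ∑ k : Fin n, r.getD k 0 * (A.getD k []).getD j 0 := by
  induction n generalizing r A with
  | zero => simp [rowComb]
  | succ n ih =>
    rw [rowComb, getD_smulAdd, ih, Fin.sum_univ_succ]
    cases r <;> cases A <;> simp

lemma toMat_listMul (n : ℕ) (A B : List (List ℤ)) :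
    toMat n (listMul n A B) = toMat n A * toMat n B := by
  ext i j
  have h : (listMul n A B).getD i [] = rowComb n (A.getD i []) B ∨
      (listMul n A B).getD i [] = [] ∧ A.getD i [] = [] := by
    rcases lt_or_ge (i : ℕ) A.length with hi | hi
    · left; simp [listMul, List.getD_eq_getElem?_getD, hi]
    · right; simp [listMul, List.getD_eq_getElem?_getD, hi]
  rw [mul_apply]
  simp only [toMat, of_apply]
  rcases h with h | ⟨h, h'⟩
  · rw [h, getD_rowComb]
    push_cast
    rfl
  · rw [h, h']
    simp

lemma getD_ofFn {β : Type*} {n : ℕ} (f : Fin n → β) (d : β) (i : Fin n) :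
    (List.ofFn f).getD i d = f i := by
  simp [List.getD_eq_getElem?_getD]

lemma toMat_listScalar (n : ℕ) (c : ℤ) : toMat n (listScalar n c) = (c : ℚ) • 1 := by
  ext i j
  simp only [toMat, listScalar, getD_ofFn, of_apply, Matrix.smul_apply, Matrix.one_apply]
  split_ifs <;> simp

lemma listTrace_eq (n : ℕ) (A : List (List ℤ)) : (listTrace n A : ℚ) = (toMat n A).trace := by
  induction n generalizing A with
  | zero => simp [listTrace, trace]
  | succ n ih =>
    have hrec : (toMat n (A.tail.map List.tail)).trace =
        ∑ i : Fin n, toMat (n + 1) A i.succ i.succ := by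
      refine Finset.sum_congr rfl fun i _ => ?_
      cases A with
      | nil => simp [toMat]
      | cons r A =>
        simp only [toMat, diag_apply, of_apply, List.tail_cons, Fin.val_succ, List.getD_cons_succ]
        rcases lt_or_ge (i : ℕ) A.length with hi | hi <;>
          simp [List.getD_eq_getElem?_getD, hi]
    have hhead : (((A.headD []).headD 0 : ℤ) : ℚ) = toMat (n + 1) A 0 0 := by
      rcases A with _ | ⟨_ | _, _⟩ <;> simp [toMat]
    rw [listTrace, Int.cast_add, ih, hrec, hhead, trace, Fin.sum_univ_succ]
    rfl

/-- The entries of `3 X` are integers. -/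
abbrev IsThirdIntegral {n : ℕ} (X : Matrix (Fin n) (Fin n) ℚ) : Prop :=
  ∀ i j, (3 * X i j).den = 1

lemma IsThirdIntegral.toMat_tripleRows {n : ℕ} {X : Matrix (Fin n) (Fin n) ℚ}
    (h : IsThirdIntegral X) : toMat n (tripleRows X) = (3 : ℚ) • X := by
  ext i j
  simp only [toMat, tripleRows, getD_ofFn, of_apply, Matrix.smul_apply, smul_eq_mul]
  exact Rat.coe_int_num_of_den_eq_one (h i j)

/-- The rows of `3 ^ k` times the product of `k` matrices. -/
def listProd {n : ℕ} : List (Matrix (Fin n) (Fin n) ℚ) → List (List ℤ)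
  | [] => listScalar n 1
  | X :: Xs => listMul n (tripleRows X) (listProd Xs)

lemma toMat_listProd {n : ℕ} {Xs : List (Matrix (Fin n) (Fin n) ℚ)}
    (h : ∀ X ∈ Xs, IsThirdIntegral X) :
    toMat n (listProd Xs) = (3 : ℚ) ^ Xs.length • Xs.prod := by
  induction Xs with
  | nil => simp [listProd, toMat_listScalar]
  | cons X Xs ih =>
    rw [List.forall_mem_cons] at h
    rw [listProd, toMat_listMul, ih h.2, h.1.toMat_tripleRows, List.prod_cons, List.length_cons,
      smul_mul_smul_comm, pow_succ']

/-- Equality of two products of matrices over `(1/3) ℤ`, as an identity of integer lists. -/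
lemma prod_eq_prod {n : ℕ} {Xs Ys : List (Matrix (Fin n) (Fin n) ℚ)}
    (hX : ∀ X ∈ Xs, IsThirdIntegral X) (hY : ∀ Y ∈ Ys, IsThirdIntegral Y)
    (h : listMul n (listScalar n (3 ^ Ys.length)) (listProd Xs) =
      listMul n (listScalar n (3 ^ Xs.length)) (listProd Ys)) : Xs.prod = Ys.prod := by
  have h' := congrArg (toMat n) h
  rw [toMat_listMul, toMat_listMul, toMat_listScalar, toMat_listScalar, toMat_listProd hX,
    toMat_listProd hY, smul_mul_smul_comm, smul_mul_smul_comm, one_mul, one_mul] at h'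
  push_cast at h'
  rw [mul_comm] at h'
  exact smul_right_injective _ (by positivity) h'

/-- With `A = 3 X`, `c = 3 ^ m` and `P = 3 ^ m X ^ m`: the integers `t₀, t₁, …` in the list are the
traces of `X ^ m, X ^ (m + 1), …`, and the power following the last of them is the identity. -/
def traceCheck (n : ℕ) (A : List (List ℤ)) : List ℤ → List (List ℤ) → ℤ → Bool
  | [], P, c => P == listScalar n c
  | t :: ts, P, c => listTrace n P == c * t && traceCheck n A ts (listMul n A P) (3 * c)

/-- `X ^ ts.length = 1`, and `ts` lists the traces of `1, X, X ^ 2, …` over this period. -/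
def HasTraces {n : ℕ} (X : Matrix (Fin n) (Fin n) ℚ) (ts : List ℤ) : Prop :=
  X ^ ts.length = 1 ∧ ∀ k < ts.length, (X ^ k).trace = ts.getD k 0

lemma hasTraces_of_traceCheck {n : ℕ} {X : Matrix (Fin n) (Fin n) ℚ} {ts : List ℤ}
    (hX : IsThirdIntegral X) (h : traceCheck n (tripleRows X) ts (listScalar n 1) 1 = true) :
    HasTraces X ts := by
  suffices key : ∀ (ts : List ℤ) (P : List (List ℤ)) (m : ℕ),
      toMat n P = (3 : ℚ) ^ m • X ^ m → traceCheck n (tripleRows X) ts P (3 ^ m) = true →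
      X ^ (m + ts.length) = 1 ∧ ∀ k < ts.length, (X ^ (m + k)).trace = ts.getD k 0 by
    simpa [HasTraces] using
      key ts (listScalar n 1) 0 (by simp [toMat_listScalar]) (by simpa using h)
  intro ts
  induction ts with
  | nil =>
    intro P m hP h
    simp only [traceCheck, beq_iff_eq] at h
    rw [h, toMat_listScalar] at hP
    push_cast at hP
    exact ⟨(smul_right_injective _ (by positivity) hP).symm, by simp⟩
  | cons t ts ih =>
    intro P m hP h
    simp only [traceCheck, Bool.and_eq_true, beq_iff_eq] at h
    obtain ⟨ht, h⟩ := h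
    have hnext : toMat n (listMul n (tripleRows X) P) = (3 : ℚ) ^ (m + 1) • X ^ (m + 1) := by
      rw [toMat_listMul, hX.toMat_tripleRows, hP, smul_mul_smul_comm, pow_succ', pow_succ' X]
    obtain ⟨hone, htr⟩ := ih _ (m + 1) hnext (by rwa [pow_succ'])
    refine ⟨by simpa [add_comm, add_left_comm] using hone, fun k hk => ?_⟩
    cases k with
    | zero =>
      have ht' : (listTrace n P : ℚ) = 3 ^ m * t := by exact_mod_cast ht
      rw [listTrace_eq, hP, trace_smul, smul_eq_mul] at ht'
      simpa using mul_left_cancel₀ (by positivity) ht'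
    | succ k =>
      have := htr k (by simpa using hk)
      simpa [add_comm, add_left_comm] using this

end Lists

/-! ### Certificates -/

section Certificates

variable {n : ℕ}

/-- Two tables of traces of powers tell apart, by the traces of an element and of its square,
every nontrivial power in the first from every power in the second. -/
def Separated (ts ts' : List ℤ) : Prop :=
  ts ≠ [] ∧ ts' ≠ [] ∧ ∀ i < ts.length, i ≠ 0 → ∀ j < ts'.length,
    ts.getD i 0 ≠ ts'.getD j 0 ∨
      ts.getD (2 * i % ts.length) 0 ≠ ts'.getD (2 * j % ts'.length) 0

instance (ts ts' : List ℤ) : Decidable (Separated ts ts') := by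
  unfold Separated; infer_instance

lemma HasTraces.trace_pow {X : Matrix (Fin n) (Fin n) ℚ} {ts : List ℤ} (h : HasTraces X ts)
    (hts : ts ≠ []) (k : ℕ) : (X ^ k).trace = ts.getD (k % ts.length) 0 := by
  rw [pow_eq_pow_mod k h.1]
  exact h.2 _ (Nat.mod_lt _ (List.length_pos_iff.2 hts))

lemma Separated.pow_eq_one {X Y : Matrix (Fin n) (Fin n) ℚ} {ts ts' : List ℤ}
    (h : Separated ts ts') (hX : HasTraces X ts) (hY : HasTraces Y ts') {i j : ℕ}
    (h₁ : (X ^ i).trace = (Y ^ j).trace) (h₂ : (X ^ (2 * i)).trace = (Y ^ (2 * j)).trace) :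
    X ^ i = 1 := by
  obtain ⟨hts, hts', h⟩ := h
  by_cases hi : i % ts.length = 0
  · rw [pow_eq_pow_mod i hX.1, hi, pow_zero]
  · rw [hX.trace_pow hts, hY.trace_pow hts', Int.cast_inj] at h₁ h₂
    have := h (i % ts.length) (Nat.mod_lt _ (List.length_pos_iff.2 hts)) hi (j % ts'.length)
      (Nat.mod_lt _ (List.length_pos_iff.2 hts'))
    rw [Nat.mul_mod_mod, Nat.mul_mod_mod] at this
    tauto

/-- The list of factors of a positive word in two letters. -/
def letters {β : Type*} (x y : β) (w : List (Fin 2)) : List β := w.map ![x, y]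

/-- A certificate that `X` and `Y` generate every reflection `S i`: a word `v` in `X, Y` is
conjugate to one `S i₀` by a word `c₀`, and `S i₀` is conjugate to each `S i` by a word `c i`.
The conjugations are written without inverses. -/
def Generates (S : Fin n → Matrix (Fin n) (Fin n) ℚ) (X Y : Matrix (Fin n) (Fin n) ℚ) : Prop :=
  ∃ (i₀ : Fin n) (c₀ v : List (Fin 2)) (c : Fin n → List (Fin 2)),
    (letters X Y (c₀ ++ v)).prod = (S i₀ :: letters X Y c₀).prod ∧
      ∀ i, (letters X Y (c i) ++ [S i₀]).prod = (S i :: letters X Y (c i)).prod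

/-- Matrix identities that make `{{X₁, Y₁}, {X₂, Y₂}}` a strongly real Beauville structure of the
group generated by the reflections `S i`, with inverting element `T`. -/
structure Certificate (S : Fin n → Matrix (Fin n) (Fin n) ℚ)
    (X₁ Y₁ X₂ Y₂ T : Matrix (Fin n) (Fin n) ℚ) : Prop where
  mem : ∀ X ∈ ({X₁, Y₁, X₂, Y₂, T} : Set (Matrix (Fin n) (Fin n) ℚ)),
    ∃ ω : List (Fin n), (ω.map S).prod = X
  generates_left : Generates S X₁ Y₁
  generates_right : Generates S X₂ Y₂
  traces : ∃ l₁ l₂ : List (List ℤ),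
    (∀ X ∈ ({X₁, Y₁, X₁ * Y₁} : Set (Matrix (Fin n) (Fin n) ℚ)), ∃ ts ∈ l₁, HasTraces X ts) ∧
    (∀ X ∈ ({X₂, Y₂, X₂ * Y₂} : Set (Matrix (Fin n) (Fin n) ℚ)), ∃ ts ∈ l₂, HasTraces X ts) ∧
    ∀ ts ∈ l₁, ∀ ts' ∈ l₂, Separated ts ts'
  involutive : T * T = 1
  ne_one : T ≠ 1
  invert : ∀ X ∈ ({X₁, Y₁, X₂, Y₂} : Set (Matrix (Fin n) (Fin n) ℚ)), X * T * X = T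

section Group

variable {M : CoxeterMatrix (Fin n)} {ρ : M.Group →* Matrix (Fin n) (Fin n) ℚ}
  {S : Fin n → Matrix (Fin n) (Fin n) ℚ}

lemma map_letters_prod (x y : M.Group) (w : List (Fin 2)) :
    ρ (letters x y w).prod = (letters (ρ x) (ρ y) w).prod := by
  rw [map_list_prod, letters, letters, List.map_map]
  congr 2
  funext b
  fin_cases b <;> rfl

lemma Generates.closure_eq_top (hinj : Function.Injective ρ) (hρ : ∀ i, ρ (M.simple i) = S i)
    {x y : M.Group} (h : Generates S (ρ x) (ρ y)) : Subgroup.closure {x, y} = ⊤ := by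
  obtain ⟨i₀, c₀, v, c, h₀, h⟩ := h
  have hmem (w : List (Fin 2)) : (letters x y w).prod ∈ Subgroup.closure {x, y} := by
    refine list_prod_mem fun z hz => Subgroup.subset_closure ?_
    obtain ⟨b, -, rfl⟩ := List.mem_map.1 hz
    fin_cases b <;> simp
  have hi₀ : M.simple i₀ ∈ Subgroup.closure {x, y} := by
    have : (letters x y (c₀ ++ v)).prod = M.simple i₀ * (letters x y c₀).prod :=
      hinj (by rw [map_letters_prod, h₀, map_mul, map_letters_prod, hρ, List.prod_cons])
    rw [eq_mul_inv_iff_mul_eq.2 this.symm]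
    exact mul_mem (hmem _) (inv_mem (hmem _))
  rw [eq_top_iff, ← M.toCoxeterSystem.subgroup_closure_range_simple, Subgroup.closure_le]
  rintro _ ⟨i, rfl⟩
  have : (letters x y (c i)).prod * M.simple i₀ = M.simple i * (letters x y (c i)).prod := by
    refine hinj ?_
    have := h i
    rw [List.prod_append, List.prod_singleton, List.prod_cons] at this
    rw [map_mul, map_mul, map_letters_prod, hρ, hρ, this]
  rw [SetLike.mem_coe, CoxeterMatrix.toCoxeterSystem_simple, eq_mul_inv_iff_mul_eq.2 this.symm]
  exact mul_mem (mul_mem (hmem _) hi₀) (inv_mem (hmem _))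

theorem Certificate.exists_structure [Finite M.Group] (hinj : Function.Injective ρ)
    (hρ : ∀ i, ρ (M.simple i) = S i) {X₁ Y₁ X₂ Y₂ T : Matrix (Fin n) (Fin n) ℚ}
    (h : Certificate S X₁ Y₁ X₂ Y₂ T) :
    ∃ x₁ y₁ x₂ y₂ t : M.Group,
      (ρ x₁ = X₁ ∧ ρ y₁ = Y₁ ∧ ρ x₂ = X₂ ∧ ρ y₂ = Y₂ ∧ ρ t = T) ∧
      IsStronglyRealBeauvilleStructure x₁ y₁ x₂ y₂ ∧ orderOf t = 2 ∧
      t⁻¹ * x₁ * t = x₁⁻¹ ∧ t⁻¹ * y₁ * t = y₁⁻¹ ∧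
      t⁻¹ * x₂ * t = x₂⁻¹ ∧ t⁻¹ * y₂ * t = y₂⁻¹ := by
  have lift (X) (hX : X ∈ ({X₁, Y₁, X₂, Y₂, T} : Set (Matrix (Fin n) (Fin n) ℚ))) :
      ∃ x, ρ x = X := by
    obtain ⟨ω, rfl⟩ := h.mem X hX
    exact ⟨(ω.map M.simple).prod, by simp [map_list_prod, Function.comp_def, hρ]⟩
  obtain ⟨x₁, rfl⟩ := lift X₁ (by simp)
  obtain ⟨y₁, rfl⟩ := lift Y₁ (by simp)
  obtain ⟨x₂, rfl⟩ := lift X₂ (by simp)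
  obtain ⟨y₂, rfl⟩ := lift Y₂ (by simp)
  obtain ⟨t, rfl⟩ := lift T (by simp)
  have invert (x) (hx : ρ x ∈ ({ρ x₁, ρ y₁, ρ x₂, ρ y₂} : Set (Matrix (Fin n) (Fin n) ℚ))) :
      t⁻¹ * x * t = x⁻¹ :=
    conj_eq_inv_of_mul_mul_eq (hinj (by rw [map_mul, map_mul]; exact h.invert _ hx))
  have hx₁ := invert x₁ (by simp)
  have hy₁ := invert y₁ (by simp)
  have hx₂ := invert x₂ (by simp)
  have hy₂ := invert y₂ (by simp)
  have hsigma : sigmaSet x₁ y₁ ∩ sigmaSet x₂ y₂ = {1} := by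
    obtain ⟨l₁, l₂, hl₁, hl₂, hsep⟩ := h.traces
    refine sigmaSet_inter_eq_one (fun g => ((ρ g).trace, (ρ (g ^ 2)).trace)) (fun g k => ?_) ?_
    · have hconj (g : M.Group) : (ρ (k⁻¹ * g * k)).trace = (ρ g).trace := by
        rw [map_mul, trace_mul_comm, ← map_mul, mul_inv_cancel_left]
      have hpow : (k⁻¹ * g * k) ^ 2 = k⁻¹ * g ^ 2 * k := by
        simpa using (conj_pow (i := 2) (a := k⁻¹) (b := g))
      simp only [hpow, hconj]
    · intro u hu v hv i j huv
      obtain ⟨ts, hts, hU⟩ := hl₁ (ρ u) (by rcases hu with rfl | rfl | rfl <;> simp)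
      obtain ⟨ts', hts', hV⟩ := hl₂ (ρ v) (by rcases hv with rfl | rfl | rfl <;> simp)
      rw [Prod.mk.injEq, ← pow_mul, ← pow_mul, mul_comm i, mul_comm j] at huv
      simp only [map_pow] at huv
      exact hinj (by rw [map_pow, map_one, (hsep ts hts ts' hts').pow_eq_one hU hV huv.1 huv.2])
  refine ⟨x₁, y₁, x₂, y₂, t, ⟨rfl, rfl, rfl, rfl, rfl⟩, ⟨⟨inferInstance,
    h.generates_left.closure_eq_top hinj hρ, h.generates_right.closure_eq_top hinj hρ, hsigma⟩,
    MulEquiv.refl _, t⁻¹, t⁻¹, ?_⟩, ?_, hx₁, hy₁, hx₂, hy₂⟩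
  · simpa using ⟨⟨hx₁, hy₁⟩, hx₂, hy₂⟩
  · refine orderOf_eq_prime (hinj ?_) fun ht => h.ne_one (by rw [ht, map_one])
    rw [pow_two, map_mul, h.involutive, map_one]

end Group

section Lists

lemma exists_traces {X₁ Y₁ X₂ Y₂ : Matrix (Fin n) (Fin n) ℚ} {a₁ b₁ c₁ a₂ b₂ c₂ : List ℤ}
    (ha₁ : HasTraces X₁ a₁) (hb₁ : HasTraces Y₁ b₁) (hc₁ : HasTraces (X₁ * Y₁) c₁)
    (ha₂ : HasTraces X₂ a₂) (hb₂ : HasTraces Y₂ b₂) (hc₂ : HasTraces (X₂ * Y₂) c₂)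
    (h : ∀ ts ∈ [a₁, b₁, c₁], ∀ ts' ∈ [a₂, b₂, c₂], Separated ts ts') :
    ∃ l₁ l₂ : List (List ℤ),
      (∀ X ∈ ({X₁, Y₁, X₁ * Y₁} : Set (Matrix (Fin n) (Fin n) ℚ)), ∃ ts ∈ l₁, HasTraces X ts) ∧
      (∀ X ∈ ({X₂, Y₂, X₂ * Y₂} : Set (Matrix (Fin n) (Fin n) ℚ)), ∃ ts ∈ l₂, HasTraces X ts) ∧
      ∀ ts ∈ l₁, ∀ ts' ∈ l₂, Separated ts ts' := by
  refine ⟨_, _, ?_, ?_, h⟩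
  · rintro X (rfl | rfl | rfl)
    exacts [⟨a₁, by simp, ha₁⟩, ⟨b₁, by simp, hb₁⟩, ⟨c₁, by simp, hc₁⟩]
  · rintro X (rfl | rfl | rfl)
    exacts [⟨a₂, by simp, ha₂⟩, ⟨b₂, by simp, hb₂⟩, ⟨c₂, by simp, hc₂⟩]

variable {S : Fin n → Matrix (Fin n) (Fin n) ℚ} {X Y : Matrix (Fin n) (Fin n) ℚ}

lemma prod_simple_eq (hS : ∀ i, IsThirdIntegral (S i)) (hX : IsThirdIntegral X)
    (ω : List (Fin n))
    (h : listMul n (listScalar n (3 ^ 1)) (listProd (ω.map S)) =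
      listMul n (listScalar n (3 ^ (ω.map S).length)) (listProd [X])) :
    ∃ ω : List (Fin n), (ω.map S).prod = X :=
  ⟨ω, (prod_eq_prod (Xs := ω.map S) (Ys := [X]) (by simpa using fun i _ => hS i)
    (by simpa using hX) h).trans List.prod_singleton⟩

/-- `Generates` from identities of integer lists. In the second family both sides have the same
number of factors, so no power of `3` is needed to compare them. -/
lemma generates_of_lists (hS : ∀ i, IsThirdIntegral (S i)) (hX : IsThirdIntegral X)
    (hY : IsThirdIntegral Y) (i₀ : Fin n) (c₀ v : List (Fin 2)) (c : Fin n → List (Fin 2))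
    (h₀ : listMul n (listScalar n (3 ^ (S i₀ :: letters X Y c₀).length))
        (listProd (letters X Y (c₀ ++ v))) =
      listMul n (listScalar n (3 ^ (letters X Y (c₀ ++ v)).length))
        (listProd (S i₀ :: letters X Y c₀)))
    (h : ∀ i, listProd (letters X Y (c i) ++ [S i₀]) = listProd (S i :: letters X Y (c i))) :
    Generates S X Y := by
  have hletters (w : List (Fin 2)) : ∀ Z ∈ letters X Y w, IsThirdIntegral Z := by
    intro Z hZ
    obtain ⟨b, -, rfl⟩ := List.mem_map.1 hZ
    fin_cases b
    exacts [hX, hY]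
  refine ⟨i₀, c₀, v, c, prod_eq_prod (hletters _) ?_ h₀, fun i => prod_eq_prod ?_ ?_ ?_⟩
  · simpa using ⟨hS i₀, hletters c₀⟩
  · intro Z hZ
    rcases List.mem_append.1 hZ with hZ | hZ
    · exact hletters _ Z hZ
    · rw [List.mem_singleton.1 hZ]; exact hS i₀
  · simpa using ⟨hS i, hletters (c i)⟩
  · rw [h i]
    simp

end Lists

end Certificates

/-! ### The simple roots of type `E` -/

/-- The simple roots of type `Eₙ` for `form`: `-(e₁ + e₂ + e₃)` for the node off the long chain, and
differences of consecutive basis vectors along the chain. The sign makes the pairing with the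
neighbouring root `e₃ - e₄` equal to `-1`; it does not change the reflection. -/
def simpleRoot (n : ℕ) (i : Fin n) : Fin n → ℚ := fun j =>
  if (i : ℕ) = 1 then (if (j : ℕ) < 3 then -1 else 0)
  -- Truncated subtraction sends both `0` and `1` to `0`: node `0` carries the difference of the
  -- coordinates `0` and `1`, node `i ≥ 2` that of the coordinates `i - 1` and `i`.
  else (if (j : ℕ) = i - 1 then 1 else 0) - (if (j : ℕ) = i - 1 + 1 then 1 else 0)

/-- The faithful representation attached to `simpleRoot`, from decidable conditions. The functional
`v ↦ -∑ j vⱼ` (coordinates numbered from `0`) is positive on the simple roots. -/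
lemma exists_representation_simpleRoot {n : ℕ} (hn : n < 9) {M : CoxeterMatrix (Fin n)}
    (hM : ∀ i j, i = j ∨ M i j = 2 ∨ M i j = 3)
    (hform : ∀ i j, form (simpleRoot n i) (simpleRoot n j) =
      if M i j = 1 then 2 else if M i j = 3 then -1 else 0)
    (hint : ∀ i, (∀ j, (simpleRoot n i j).den = 1) ∧ 3 ∣ ∑ j, (simpleRoot n i j).num)
    (hheight : ∀ i, 0 < (fun j : Fin n => -(j : ℚ)) ⬝ᵥ simpleRoot n i) :
    ∃ ρ : M.Group →* Matrix (Fin n) (Fin n) ℚ, Function.Injective ρ ∧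
      (∀ i, ρ (M.simple i) = refl (simpleRoot n i)) ∧ Finite M.Group := by
  refine exists_faithful_representation hn M.diagonal (fun i j => (hM i j).resolve_left)
    (fun i => ⟨?_, ?_⟩) (fun i j h => ?_) (fun i j h => ?_) _ hheight
  · rw [hform, M.diagonal, if_pos rfl]
  · obtain ⟨hden, d, hd⟩ := hint i
    exact ⟨_, d, fun j => (Rat.coe_int_num_of_den_eq_one (hden j)).symm, hd⟩
  · rw [hform, h]; rfl
  · rw [hform, h]; rfl

/-! ### The group `W(E₆)` -/

lemma e6Simple_eq (i : Fin 6) : e6Simple i = refl (simpleRoot 6 i) := by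
  revert i; decide +kernel

theorem exists_representation_e6 :
    ∃ ρ : CoxeterMatrix.E₆.Group →* Matrix (Fin 6) (Fin 6) ℚ, Function.Injective ρ ∧
      (∀ i, ρ (CoxeterMatrix.E₆.simple i) = e6Simple i) ∧ Finite CoxeterMatrix.E₆.Group := by
  simp only [e6Simple_eq]
  exact exists_representation_simpleRoot (by norm_num)
    (fun i => by fin_cases i <;> decide +kernel) (by decide +kernel)
    (by decide +kernel) (by decide +kernel)

lemma isThirdIntegral_e6Simple : ∀ i, IsThirdIntegral (e6Simple i) := by decide +kernel

lemma isThirdIntegral_e6X1 : IsThirdIntegral e6X1 := by decide +kernel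

lemma isThirdIntegral_e6Y1 : IsThirdIntegral e6Y1 := by decide +kernel

lemma isThirdIntegral_e6X2 : IsThirdIntegral e6X2 := by decide +kernel

lemma isThirdIntegral_e6Y2 : IsThirdIntegral e6Y2 := by decide +kernel

lemma generates_e6_left : Generates e6Simple e6X1 e6Y1 :=
  generates_of_lists isThirdIntegral_e6Simple isThirdIntegral_e6X1 isThirdIntegral_e6Y1
    0 [0, 0, 0, 1] ((List.replicate 3 [0, 1, 1]).flatten)
    ![[], [1, 0, 1, 0, 1], [0, 1], [0, 0, 0], [0, 0, 1], [1, 1]]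
    (by decide +kernel) (by decide +kernel)

lemma generates_e6_right : Generates e6Simple e6X2 e6Y2 :=
  generates_of_lists isThirdIntegral_e6Simple isThirdIntegral_e6X2 isThirdIntegral_e6Y2
    0 [1, 0, 1] ((List.replicate 5 [0]).flatten)
    ![[], [0, 0], [1, 1, 0, 0], [0, 0, 1, 0], [0, 1, 0, 0], [1, 0, 1]]
    (by decide +kernel) (by decide +kernel)

lemma hasTraces_e6X1 : HasTraces e6X1 [6, 0, 0, 0, 0, 0] :=
  hasTraces_of_traceCheck isThirdIntegral_e6X1 (by decide +kernel)

lemma hasTraces_e6Y1 : HasTraces e6Y1 [6, 2, -2, 2] :=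
  hasTraces_of_traceCheck isThirdIntegral_e6Y1 (by decide +kernel)

lemma hasTraces_e6X1_mul_e6Y1 : HasTraces (e6X1 * e6Y1) [6, 0, 2, 0, -2, 0, 2, 0] :=
  hasTraces_of_traceCheck (by decide +kernel) (by decide +kernel)

lemma hasTraces_e6X2 : HasTraces e6X2 [6, -1, 1, -1, 1, 4, 1, -1, 1, -1] :=
  hasTraces_of_traceCheck isThirdIntegral_e6X2 (by decide +kernel)

lemma hasTraces_e6Y2 : HasTraces e6Y2 [6, 1, 1, 1, 1] :=
  hasTraces_of_traceCheck isThirdIntegral_e6Y2 (by decide +kernel)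

lemma hasTraces_e6X2_mul_e6Y2 : HasTraces (e6X2 * e6Y2) [6, 1, -1, -2, 3, 1, 2, 1, 3, -2, -1, 1] :=
  hasTraces_of_traceCheck (by decide +kernel) (by decide +kernel)

theorem certificate_e6 : Certificate e6Simple e6X1 e6Y1 e6X2 e6Y2 e6T where
  mem := by
    rintro X (rfl | rfl | rfl | rfl | rfl)
    · exact prod_simple_eq isThirdIntegral_e6Simple isThirdIntegral_e6X1
        [0, 2, 3, 4, 5, 2, 3, 4, 2] (by decide +kernel)
    · exact prod_simple_eq isThirdIntegral_e6Simple isThirdIntegral_e6Y1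
        [0, 2, 1, 3, 4, 5, 4, 3, 0, 2, 1, 3, 4, 3, 0, 2, 1, 3] (by decide +kernel)
    · exact prod_simple_eq isThirdIntegral_e6Simple isThirdIntegral_e6X2
        [5, 3, 0, 2, 1] (by decide +kernel)
    · exact prod_simple_eq isThirdIntegral_e6Simple isThirdIntegral_e6Y2
        [5, 4, 3, 0, 2, 1, 3, 4, 5, 4, 3, 0, 2, 1, 3, 4] (by decide +kernel)
    · exact prod_simple_eq isThirdIntegral_e6Simple (by decide +kernel)
        [5, 3, 0] (by decide +kernel)
  generates_left := generates_e6_left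
  generates_right := generates_e6_right
  traces := exists_traces hasTraces_e6X1 hasTraces_e6Y1 hasTraces_e6X1_mul_e6Y1
    hasTraces_e6X2 hasTraces_e6Y2 hasTraces_e6X2_mul_e6Y2 (by decide +kernel)
  involutive := by decide +kernel
  ne_one := by decide +kernel
  invert := by
    rintro X (rfl | rfl | rfl | rfl) <;> decide +kernel

/-! ### The group `W(E₇)` -/

lemma e7Simple_eq (i : Fin 7) : e7Simple i = refl (simpleRoot 7 i) := by
  revert i; decide +kernel

theorem exists_representation_e7 :
    ∃ ρ : CoxeterMatrix.E₇.Group →* Matrix (Fin 7) (Fin 7) ℚ, Function.Injective ρ ∧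
      (∀ i, ρ (CoxeterMatrix.E₇.simple i) = e7Simple i) ∧ Finite CoxeterMatrix.E₇.Group := by
  simp only [e7Simple_eq]
  exact exists_representation_simpleRoot (by norm_num)
    (fun i => by fin_cases i <;> decide +kernel) (by decide +kernel)
    (by decide +kernel) (by decide +kernel)

lemma isThirdIntegral_e7Simple : ∀ i, IsThirdIntegral (e7Simple i) := by decide +kernel

lemma isThirdIntegral_e7X1 : IsThirdIntegral e7X1 := by decide +kernel

lemma isThirdIntegral_e7Y1 : IsThirdIntegral e7Y1 := by decide +kernel

lemma isThirdIntegral_e7X2 : IsThirdIntegral e7X2 := by decide +kernel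

lemma isThirdIntegral_e7Y2 : IsThirdIntegral e7Y2 := by decide +kernel

lemma generates_e7_left : Generates e7Simple e7X1 e7Y1 :=
  generates_of_lists isThirdIntegral_e7Simple isThirdIntegral_e7X1 isThirdIntegral_e7Y1
    3 [0, 1, 0, 0, 1, 0] ((List.replicate 3 [0, 0, 0, 0, 0, 1, 0, 1, 1]).flatten)
    ![[0, 0, 0, 0, 0, 1], [0, 1, 0, 0, 1, 0], [0, 1, 1, 1, 0, 0], [], [1, 1, 1], [0, 1, 0, 0,
      1], [0, 0, 0, 1, 1]]
    (by decide +kernel) (by decide +kernel)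

lemma generates_e7_right : Generates e7Simple e7X2 e7Y2 :=
  generates_of_lists isThirdIntegral_e7Simple isThirdIntegral_e7X2 isThirdIntegral_e7Y2
    4 [1, 0, 1, 0] ((List.replicate 5 [0, 0, 1, 1, 0, 1, 1, 1]).flatten)
    ![[1, 1], [0, 1, 0, 1, 0, 1, 0], [0, 1, 1], [1, 1, 1], [], [0], [1]]
    (by decide +kernel) (by decide +kernel)

lemma hasTraces_e7X1 : HasTraces e7X1 [7, 1, 3, 1, -1, 1, 3, 1] :=
  hasTraces_of_traceCheck isThirdIntegral_e7X1 (by decide +kernel)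

lemma hasTraces_e7Y1 : HasTraces e7Y1 [7, -3, -1, -3] :=
  hasTraces_of_traceCheck isThirdIntegral_e7Y1 (by decide +kernel)

lemma hasTraces_e7X1_mul_e7Y1 : HasTraces (e7X1 * e7Y1)
    [7, -1, -1, 2, -1, 4, 2, -1, -1, 2, 4, -1, 2, -1, -1] :=
  hasTraces_of_traceCheck (by decide +kernel) (by decide +kernel)

lemma hasTraces_e7X2 : HasTraces e7X2 [7, 0, 0, 0, 0, 0, 0, -7, 0, 0, 0, 0, 0, 0] :=
  hasTraces_of_traceCheck isThirdIntegral_e7X2 (by decide +kernel)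

lemma hasTraces_e7Y2 : HasTraces e7Y2 [7, 0, 0, 0, 0, 0, 0] :=
  hasTraces_of_traceCheck isThirdIntegral_e7Y2 (by decide +kernel)

lemma hasTraces_e7X2_mul_e7Y2 : HasTraces (e7X2 * e7Y2) [7, -2, -2, 1, -2, -2] :=
  hasTraces_of_traceCheck (by decide +kernel) (by decide +kernel)

theorem certificate_e7 : Certificate e7Simple e7X1 e7Y1 e7X2 e7Y2 e7T where
  mem := by
    rintro X (rfl | rfl | rfl | rfl | rfl)
    · exact prod_simple_eq isThirdIntegral_e7Simple isThirdIntegral_e7X1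
        [5, 4, 2, 3, 0, 2, 1, 3, 4, 5, 6, 5, 2, 3, 4, 2, 0] (by decide +kernel)
    · exact prod_simple_eq isThirdIntegral_e7Simple isThirdIntegral_e7Y1
        [5, 6, 0, 2, 3, 4, 5, 1, 3, 4, 2, 3, 0, 2, 1, 3, 4, 5, 6, 1, 3, 4, 2, 3, 0, 2, 1, 3, 4,
         5, 4, 3, 0, 2, 1, 3, 4, 0, 2, 1, 3]
        (by decide +kernel)
    · exact prod_simple_eq isThirdIntegral_e7Simple isThirdIntegral_e7X2
        [1, 3, 4, 5, 6, 2, 3, 4, 5, 1, 3, 4, 2, 3, 0, 2, 1, 3, 4, 5, 6, 0, 2, 3, 4, 5, 1, 3, 4,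
         2, 3, 0, 2, 1, 3, 4, 5, 1, 3, 4, 2, 3, 0, 2, 1, 3, 4, 2, 3, 0, 2, 1, 3, 0, 2, 1, 0]
        (by decide +kernel)
    · exact prod_simple_eq isThirdIntegral_e7Simple isThirdIntegral_e7Y2
        [2, 3, 4, 5, 6, 0, 2, 3, 4, 5, 2, 3, 0, 2, 1, 3, 4, 3, 2, 1, 3, 0, 2, 1] (by decide +kernel)
    · exact prod_simple_eq isThirdIntegral_e7Simple (by decide +kernel)
        [0, 2, 3, 4, 5, 6, 0, 2, 3, 4, 5, 0, 2, 3, 4, 0, 2, 3, 0, 2, 0] (by decide +kernel)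
  generates_left := generates_e7_left
  generates_right := generates_e7_right
  traces := exists_traces hasTraces_e7X1 hasTraces_e7Y1 hasTraces_e7X1_mul_e7Y1
    hasTraces_e7X2 hasTraces_e7Y2 hasTraces_e7X2_mul_e7Y2 (by decide +kernel)
  involutive := by decide +kernel
  ne_one := by decide +kernel
  invert := by
    rintro X (rfl | rfl | rfl | rfl) <;> decide +kernel

/-! ### The group `W(E₈)` -/

lemma e8Simple_eq (i : Fin 8) : e8Simple i = refl (simpleRoot 8 i) := by
  revert i; decide +kernel

theorem exists_representation_e8 :
    ∃ ρ : CoxeterMatrix.E₈.Group →* Matrix (Fin 8) (Fin 8) ℚ, Function.Injective ρ ∧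
      (∀ i, ρ (CoxeterMatrix.E₈.simple i) = e8Simple i) ∧ Finite CoxeterMatrix.E₈.Group := by
  simp only [e8Simple_eq]
  exact exists_representation_simpleRoot (by norm_num)
    (fun i => by fin_cases i <;> decide +kernel) (by decide +kernel)
    (by decide +kernel) (by decide +kernel)

lemma isThirdIntegral_e8Simple : ∀ i, IsThirdIntegral (e8Simple i) := by decide +kernel

lemma isThirdIntegral_e8X1 : IsThirdIntegral e8X1 := by decide +kernel

lemma isThirdIntegral_e8Y1 : IsThirdIntegral e8Y1 := by decide +kernel

lemma isThirdIntegral_e8X2 : IsThirdIntegral e8X2 := by decide +kernel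

lemma isThirdIntegral_e8Y2 : IsThirdIntegral e8Y2 := by decide +kernel

lemma generates_e8_left : Generates e8Simple e8X1 e8Y1 :=
  generates_of_lists isThirdIntegral_e8Simple isThirdIntegral_e8X1 isThirdIntegral_e8Y1
    0 [1, 1, 1, 0, 0, 0, 1, 0] ((List.replicate 15 [0, 0, 1]).flatten)
    ![[], [1, 0, 1, 0, 0, 0], [0, 0, 0, 1], [1, 1, 1, 1], [0, 1], [0, 0], [1, 0, 0, 0, 1], [0,
      1, 1, 1, 1]]
    (by decide +kernel) (by decide +kernel)

lemma generates_e8_right : Generates e8Simple e8X2 e8Y2 :=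
  generates_of_lists isThirdIntegral_e8Simple isThirdIntegral_e8X2 isThirdIntegral_e8Y2
    4 [1, 1, 1, 1, 1, 0, 0] ((List.replicate 5 [1]).flatten)
    ![[1, 0, 1, 1], [1, 0, 0, 0, 0, 1, 0, 1, 0, 1, 0], [0, 1, 0, 1, 0, 0, 1, 0], [0, 0, 0, 0],
      [], [0, 0, 0, 1, 1, 1, 1], [0, 0], [1, 1, 0]]
    (by decide +kernel) (by decide +kernel)

lemma hasTraces_e8X1 : HasTraces e8X1 [8, 0, 0, 0] :=
  hasTraces_of_traceCheck isThirdIntegral_e8X1 (by decide +kernel)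

lemma hasTraces_e8Y1 : HasTraces e8Y1 [8, 0, 0, 0, 0, 0, 0, 0] :=
  hasTraces_of_traceCheck isThirdIntegral_e8Y1 (by decide +kernel)

lemma hasTraces_e8X1_mul_e8Y1 : HasTraces (e8X1 * e8Y1)
    [8, 1, 1, -2, -3, 1, 4, 1, 5, -2, 1, 1, 0, 1, 1, -2, 5, 1, 4, 1, -3, -2, 1, 1] :=
  hasTraces_of_traceCheck (by decide +kernel) (by decide +kernel)

lemma hasTraces_e8X2 : HasTraces e8X2 [8, 3, 3, 3, 3] :=
  hasTraces_of_traceCheck isThirdIntegral_e8X2 (by decide +kernel)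

lemma hasTraces_e8Y2 : HasTraces e8Y2 [8, 1, 3, 1, 3, 6, 3, 1, 3, 1] :=
  hasTraces_of_traceCheck isThirdIntegral_e8Y2 (by decide +kernel)

lemma hasTraces_e8X2_mul_e8Y2 : HasTraces (e8X2 * e8Y2)
    [8, 0, 2, 3, 2, 0, -1, 0, 2, -6, 2, 0, -1, 0, 2, 3, 2, 0] :=
  hasTraces_of_traceCheck (by decide +kernel) (by decide +kernel)

theorem certificate_e8 : Certificate e8Simple e8X1 e8Y1 e8X2 e8Y2 e8T where
  mem := by
    rintro X (rfl | rfl | rfl | rfl | rfl)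
    · exact prod_simple_eq isThirdIntegral_e8Simple isThirdIntegral_e8X1
        [4, 5, 6, 7, 3, 4, 5, 6, 3, 4, 5, 0, 2, 3, 4, 3] (by decide +kernel)
    · exact prod_simple_eq isThirdIntegral_e8Simple isThirdIntegral_e8Y1
        [5, 6, 2, 3, 4, 5, 1, 3, 4, 2, 3, 0, 2, 1, 3, 4, 5, 6, 7, 6, 5, 4, 3, 2, 1, 3, 4, 5, 6,
         0, 2, 3, 4, 5, 1, 3, 4, 2, 3, 0, 2, 1, 3, 4, 5, 6, 7, 4, 5, 6, 2, 3, 4, 5, 1, 3, 4, 2, 3,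
         0, 2, 1, 3, 4, 5, 6, 4, 5, 3, 4, 2, 3, 0, 2, 1, 3, 4, 2, 3, 0, 2, 1, 3, 2, 0]
        (by decide +kernel)
    · exact prod_simple_eq isThirdIntegral_e8Simple isThirdIntegral_e8X2
        [6, 3, 4, 5] (by decide +kernel)
    · exact prod_simple_eq isThirdIntegral_e8Simple isThirdIntegral_e8Y2
        [2, 3, 4, 5, 6, 7, 3, 2, 1, 3, 4, 5, 6, 0, 2, 3, 4, 5, 1, 3, 4, 2, 3, 0, 2, 1, 3, 4, 5,
         6, 7, 5, 6, 4, 5, 1, 3, 4, 2, 3, 0, 2, 1, 3, 4, 5, 6, 2, 3, 4, 5, 1, 3, 4, 2, 3, 0, 2, 1,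
         3, 4, 5, 1, 3, 4, 2, 1, 3, 0, 2, 0]
        (by decide +kernel)
    · exact prod_simple_eq isThirdIntegral_e8Simple (by decide +kernel)
        [5, 3, 0] (by decide +kernel)
  generates_left := generates_e8_left
  generates_right := generates_e8_right
  traces := exists_traces hasTraces_e8X1 hasTraces_e8Y1 hasTraces_e8X1_mul_e8Y1
    hasTraces_e8X2 hasTraces_e8Y2 hasTraces_e8X2_mul_e8Y2 (by decide +kernel)
  involutive := by decide +kernel
  ne_one := by decide +kernel
  invert := by
    rintro X (rfl | rfl | rfl | rfl) <;> decide +kernel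

end BeauvilleCoxeter

theorem mainTheorem8 :
    (BeauvilleCoxeter.IsStronglyRealBeauvilleGroup CoxeterMatrix.E₆.Group ∧
      BeauvilleCoxeter.IsStronglyRealBeauvilleGroup CoxeterMatrix.E₇.Group ∧
      BeauvilleCoxeter.IsStronglyRealBeauvilleGroup CoxeterMatrix.E₈.Group) ∧
    (∃ ρ : CoxeterMatrix.E₆.Group →* Matrix (Fin 6) (Fin 6) ℚ,
      Function.Injective ρ ∧
      (∀ i, ρ (CoxeterMatrix.E₆.simple i) = BeauvilleCoxeter.e6Simple i) ∧
      ∃ x₁ y₁ x₂ y₂ t : CoxeterMatrix.E₆.Group,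
        (ρ x₁ = BeauvilleCoxeter.e6X1 ∧ ρ y₁ = BeauvilleCoxeter.e6Y1 ∧
          ρ x₂ = BeauvilleCoxeter.e6X2 ∧ ρ y₂ = BeauvilleCoxeter.e6Y2 ∧
          ρ t = BeauvilleCoxeter.e6T) ∧
        BeauvilleCoxeter.IsStronglyRealBeauvilleStructure x₁ y₁ x₂ y₂ ∧
        orderOf t = 2 ∧
        t⁻¹ * x₁ * t = x₁⁻¹ ∧ t⁻¹ * y₁ * t = y₁⁻¹ ∧
        t⁻¹ * x₂ * t = x₂⁻¹ ∧ t⁻¹ * y₂ * t = y₂⁻¹) ∧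
    (∃ ρ : CoxeterMatrix.E₇.Group →* Matrix (Fin 7) (Fin 7) ℚ,
      Function.Injective ρ ∧
      (∀ i, ρ (CoxeterMatrix.E₇.simple i) = BeauvilleCoxeter.e7Simple i) ∧
      ∃ x₁ y₁ x₂ y₂ t : CoxeterMatrix.E₇.Group,
        (ρ x₁ = BeauvilleCoxeter.e7X1 ∧ ρ y₁ = BeauvilleCoxeter.e7Y1 ∧
          ρ x₂ = BeauvilleCoxeter.e7X2 ∧ ρ y₂ = BeauvilleCoxeter.e7Y2 ∧
          ρ t = BeauvilleCoxeter.e7T) ∧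
        BeauvilleCoxeter.IsStronglyRealBeauvilleStructure x₁ y₁ x₂ y₂ ∧
        orderOf t = 2 ∧
        t⁻¹ * x₁ * t = x₁⁻¹ ∧ t⁻¹ * y₁ * t = y₁⁻¹ ∧
        t⁻¹ * x₂ * t = x₂⁻¹ ∧ t⁻¹ * y₂ * t = y₂⁻¹) ∧
    (∃ ρ : CoxeterMatrix.E₈.Group →* Matrix (Fin 8) (Fin 8) ℚ,
      Function.Injective ρ ∧
      (∀ i, ρ (CoxeterMatrix.E₈.simple i) = BeauvilleCoxeter.e8Simple i) ∧
      ∃ x₁ y₁ x₂ y₂ t : CoxeterMatrix.E₈.Group,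
        (ρ x₁ = BeauvilleCoxeter.e8X1 ∧ ρ y₁ = BeauvilleCoxeter.e8Y1 ∧
          ρ x₂ = BeauvilleCoxeter.e8X2 ∧ ρ y₂ = BeauvilleCoxeter.e8Y2 ∧
          ρ t = BeauvilleCoxeter.e8T) ∧
        BeauvilleCoxeter.IsStronglyRealBeauvilleStructure x₁ y₁ x₂ y₂ ∧
        orderOf t = 2 ∧
        t⁻¹ * x₁ * t = x₁⁻¹ ∧ t⁻¹ * y₁ * t = y₁⁻¹ ∧
        t⁻¹ * x₂ * t = x₂⁻¹ ∧ t⁻¹ * y₂ * t = y₂⁻¹) := by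
  obtain ⟨ρ₆, inj₆, simple₆, _⟩ := BeauvilleCoxeter.exists_representation_e6
  obtain ⟨ρ₇, inj₇, simple₇, _⟩ := BeauvilleCoxeter.exists_representation_e7
  obtain ⟨ρ₈, inj₈, simple₈, _⟩ := BeauvilleCoxeter.exists_representation_e8
  have h₆ := BeauvilleCoxeter.certificate_e6.exists_structure inj₆ simple₆
  have h₇ := BeauvilleCoxeter.certificate_e7.exists_structure inj₇ simple₇
  have h₈ := BeauvilleCoxeter.certificate_e8.exists_structure inj₈ simple₈
  refine ⟨⟨?_, ?_, ?_⟩, ⟨ρ₆, inj₆, simple₆, h₆⟩, ⟨ρ₇, inj₇, simple₇, h₇⟩,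
    ⟨ρ₈, inj₈, simple₈, h₈⟩⟩
  · obtain ⟨x₁, y₁, x₂, y₂, t, -, h, -⟩ := h₆
    exact ⟨x₁, y₁, x₂, y₂, h⟩
  · obtain ⟨x₁, y₁, x₂, y₂, t, -, h, -⟩ := h₇
    exact ⟨x₁, y₁, x₂, y₂, h⟩
  · obtain ⟨x₁, y₁, x₂, y₂, t, -, h, -⟩ := h₈
    exact ⟨x₁, y₁, x₂, y₂, h⟩
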